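/- Let $X_1,X_2,\dots$ be i.i.d. random variables on a probability space, with distribution function $F$ on $\mathbb{R}^+=[0,\infty)$ having a density $f$ with $f(x)>0$ for all $x>0$ and finite mean $E(X)<\infty$ (the variance may be infinite). Write $\overline F=1-F$ and $$e(x)=E(X-x\mid X>x)=\frac{\int_x^\infty \overline F(y)\,dy}{\overline F(x)},\qquad x\ge 0,$$ for the mean residual life function. Let $\mathbb F_n(x)=n^{-1}\#\{i\le n: X_i\le x\}$, $\overline{\mathbb F}_n=1-\mathbb F_n$, $X_{nn}=\max_{1\le i\le n}X_i$, and $$\hat e_n(x)=\frac{\int_x^\infty\overline{\mathbb F}_n(y)\,dy}{\overline{\mathbb F}_n(x)}\ \text{ for } 0\le x<X_{nn},\qquad \hat e_n(x)=0\ \text{ for } x\ge X_{nn}.$$ Let $\mathcal H(\downarrow)$ be the set of all nonnegative, decreasing (i.e. nonincreasing) functions $h:[0,1]\to[0,\infty)$ with $\int_0^1 \frac{1}{h(t)}\,dt<\infty$ (where $1/0=\infty$). Let $\alpha>1$, $a_n=\alpha n^{-1}\log\log n$ and $b_n=F^{-1}(1-a_n)$ (for $n$ so large that $0<a_n<1$),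 where $F^{-1}(p)=\inf\{x\ge 0: F(x)\ge p\}$. (a) If $h\in\mathcal H(\downarrow)$ satisfies Condition 1a, i.e. $$\sup_{x\ge 0}\frac{\int_x^\infty h(F(y))\,dy\,/\,h(F(x))}{e(x)}<\infty,$$ then, for this $h$, $$\sup_{0\le x\le b_n}\frac{|\hat e_n(x)-e(x)|\,\overline F(x)}{h(F(x))\,e(x)}\longrightarrow 0\quad\text{almost surely as } n\to\infty.$$ (b) If Condition 1b holds, i.e. there exists $h\in\mathcal H(\downarrow)$ with $\int_0^\infty h(F(y))\,dy<\infty$ and $\sup_{x\ge0} e(x)\,h(F(x))<\infty$, then $$\sup_{0\le x\le b_n}|\hat e_n(x)-e(x)|\,\overline F(x)\longrightarrow 0\quad\text{almost surely as } n\to\infty.$$ -/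

import Mathlib

open MeasureTheory ProbabilityTheory Filter Topology Set
open scoped ENNReal

noncomputable section

namespace MRL

/-- The survival function `1 - F` of a distribution function `F`. -/
def survival (F : ℝ → ℝ) (x : ℝ) : ℝ := 1 - F x

/-- The mean residual life function `e_F(x) = (∫_x^∞ (1 - F(y)) dy) / (1 - F(x))`. -/
def meanResidualLife (F : ℝ → ℝ) (x : ℝ) : ℝ :=
  (∫ y in Ioi x, survival F y) / survival F x

/-- The empirical distribution function `n⁻¹ #{i < n : X i ω ≤ x}` of the first `n` observations
`X 0, …, X (n - 1)`. -/
def empiricalCDF {Ω : Type*} (X : ℕ → Ω → ℝ) (n : ℕ) (ω : Ω) (x : ℝ) : ℝ :=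
  (((Finset.range n).filter (fun i => X i ω ≤ x)).card : ℝ) / n

/-- The largest of the first `n` observations. -/
def sampleMax {Ω : Type*} (X : ℕ → Ω → ℝ) (n : ℕ) (ω : Ω) : ℝ := ⨆ i : Fin n, X i ω

/-- The empirical mean residual life function: the mean residual life function of the empirical
distribution function on `[0, sampleMax)`, and `0` elsewhere. -/
def empiricalMRL {Ω : Type*} (X : ℕ → Ω → ℝ) (n : ℕ) (ω : Ω) : ℝ → ℝ :=
  (Ico 0 (sampleMax X n ω)).indicator (meanResidualLife (empiricalCDF X n ω))

/-- The quantile function `F⁻¹(p) = inf {x ≥ 0 : F(x) ≥ p}` of a distribution function on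
`[0, ∞)`. -/
def quantile (F : ℝ → ℝ) (p : ℝ) : ℝ := sInf {x : ℝ | 0 ≤ x ∧ p ≤ F x}

/-- The sequence `a_n = α n⁻¹ log log n`. -/
def aSeq (α : ℝ) (n : ℕ) : ℝ := α * (n : ℝ)⁻¹ * Real.log (Real.log n)

/-- The sequence `b_n = F⁻¹(1 - a_n)`. -/
def bSeq (F : ℝ → ℝ) (α : ℝ) (n : ℕ) : ℝ := quantile F (1 - aSeq α n)

/-- The class of nonnegative, decreasing functions `h` on `[0, 1]` such that `∫₀¹ 1/h < ∞`.
The reciprocal is taken in `[0, ∞]`, so that `1/0 = ∞`. -/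
structure MemH (h : ℝ → ℝ) : Prop where
  nonneg : ∀ t ∈ Icc (0 : ℝ) 1, 0 ≤ h t
  antitone : AntitoneOn h (Icc 0 1)
  lintegral_inv_lt_top : (∫⁻ t in Icc (0 : ℝ) 1, (ENNReal.ofReal (h t))⁻¹) < ∞

/-- `M₁(h, F) = sup_{x ≥ 0} (∫_x^∞ h(F(y)) dy / h(F(x))) / e_F(x)`, with values in `[0, ∞]`. -/
def mOne (h F : ℝ → ℝ) : ℝ≥0∞ :=
  ⨆ x ∈ Ici (0 : ℝ), ((∫⁻ y in Ioi x, ENNReal.ofReal (h (F y))) / ENNReal.ofReal (h (F x)))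
    / ENNReal.ofReal (meanResidualLife F x)

/-- Condition 1a for a particular `h`. -/
def Condition1a (h F : ℝ → ℝ) : Prop := MemH h ∧ mOne h F < ∞

/-- Condition 1b. -/
def Condition1b (F : ℝ → ℝ) : Prop :=
  ∃ h : ℝ → ℝ, MemH h ∧ (∫⁻ y in Ioi (0 : ℝ), ENNReal.ofReal (h (F y))) < ∞ ∧
    (⨆ x ∈ Ici (0 : ℝ), ENNReal.ofReal (meanResidualLife F x * h (F x))) < ∞

end MRL

end

namespace MRL

/-! With S = 1 - F and Sₙ = 1 - Fₙ, everything rests on the identity (êₙ - e) S = (S / Sₙ) (∫ₓ^∞ (Sₙ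
- S) + e (S - Sₙ)), used in `abs_meanResidualLife_sub_mul_le`. Two almost sure facts control the
right side for large n. The ratio S / Sₙ is bounded on [0, bₙ]
(`exists_ae_eventually_mul_survival_le`): a Chernoff bound and Borel–Cantelli along a geometric
sequence of sample sizes, where α > 1 makes the probabilities summable. Moreover |Fₙ - F| ≤ δ h(F)
on [0, ∞) for every δ > 0 (`ae_eventually_abs_empiricalCDF_sub_cdf_le_mul`), from the strong law
applied to 1 / h(F(X)), integrable because ∫ 1/h < ∞. Hence |êₙ - e| S is at most a constant times δ
(∫ₓ^∞ h(F) + e h(F)) (`ae_tendsto_iSup_empiricalMRL`). Condition 1a bounds the last bracket by a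
multiple of h(F) e, Condition 1b by a constant. -/

lemma cdf_mem_Icc (ν : Measure ℝ) (x : ℝ) : cdf ν x ∈ Icc (0 : ℝ) 1 :=
  ⟨cdf_nonneg ν x, cdf_le_one ν x⟩

/-- A zero at t < 1 would propagate to all of [t, 1] by monotonicity, making 1/h infinite on a set
of positive measure. -/
lemma MemH.pos {h : ℝ → ℝ} (hh : MemH h) {t : ℝ} (h0 : 0 ≤ t) (h1 : t < 1) : 0 < h t := by
  refine lt_of_le_of_ne (hh.nonneg t ⟨h0, h1.le⟩) fun he => ?_
  refine hh.lintegral_inv_lt_top.not_ge ?_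
  have hsub : Icc t 1 ⊆ Icc (0 : ℝ) 1 := Icc_subset_Icc_left h0
  refine le_trans ?_ (lintegral_mono_set hsub)
  have : ∫⁻ s in Icc t 1, (ENNReal.ofReal (h s))⁻¹ = ∫⁻ _ in Icc t 1, (∞ : ℝ≥0∞) := by
    refine setLIntegral_congr_fun measurableSet_Icc fun s hs => ?_
    have : h s ≤ 0 := he ▸ hh.antitone ⟨h0, h1.le⟩ (hsub hs) hs.1
    simp [ENNReal.ofReal_of_nonpos this]
  rw [this, setLIntegral_const, Real.volume_Icc, ENNReal.top_mul]
  simpa using h1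

lemma MemH.antitone_comp_cdf {ν : Measure ℝ} {h : ℝ → ℝ} (hh : MemH h) : Antitone fun x => h (cdf ν x) :=
  fun _ _ hxy => hh.antitone (cdf_mem_Icc _ _) (cdf_mem_Icc _ _) (monotone_cdf ν hxy)

lemma MemH.monotone_inv_comp_cdf {ν : Measure ℝ} {h : ℝ → ℝ} (hh : MemH h) (hlt : ∀ x, cdf ν x < 1) :
    Monotone fun x => (h (cdf ν x))⁻¹ := fun _ y hxy =>
  inv_anti₀ (hh.pos (cdf_nonneg ν y) (hlt y)) (hh.antitone_comp_cdf hxy)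

/-! ### Atomless distributions and the probability integral transform -/

section Distribution

variable {ν : Measure ℝ} [IsProbabilityMeasure ν]

lemma continuous_cdf [NullSingletonClass ν] : Continuous (cdf ν) := by
  refine continuous_iff_continuousAt.2 fun x => ?_
  rw [(monotone_cdf ν).continuousAt_iff_leftLim_eq_rightLim, (cdf ν).rightLim_eq]
  have h : (cdf ν).measure {x} = 0 := by rw [measure_cdf]; simp
  rw [StieltjesFunction.measure_singleton, ENNReal.ofReal_eq_zero] at h
  exact le_antisymm ((monotone_cdf ν).leftLim_le le_rfl) (by linarith)

lemma survival_cdf_eq_measureReal_Ioi (x : ℝ) : survival (cdf ν) x = ν.real (Ioi x) := by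
  rw [survival, cdf_eq_real, ← compl_Iic, probReal_compl_eq_one_sub measurableSet_Iic]

lemma exists_cdf_eq [NullSingletonClass ν] {a : ℝ} (h0 : 0 < a) (h1 : a < 1) : ∃ y, cdf ν y = a :=
  mem_range_of_exists_le_of_exists_ge continuous_cdf
    (((tendsto_cdf_atBot ν).eventually_lt_const h0).exists.imp fun _ h => h.le)
    (((tendsto_cdf_atTop ν).eventually_const_lt h1).exists.imp fun _ h => h.le)

lemma measureReal_cdf_le [NullSingletonClass ν] {a : ℝ} (h0 : 0 ≤ a) (h1 : a < 1) :
    ν.real {x | cdf ν x ≤ a} = a := by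
  apply le_antisymm
  -- If F(y) = b > a, then {F ≤ a} lies in (-∞, y], which has mass b; let b decrease to a.
  · refine le_of_forall_gt_imp_ge_of_dense fun b hb => ?_
    rcases le_or_gt 1 b with hb1 | hb1
    · exact measureReal_le_one.trans hb1
    · obtain ⟨y, hy⟩ := exists_cdf_eq (ν := ν) (h0.trans_lt hb) hb1
      rw [← hy, cdf_eq_real]
      refine measureReal_mono fun x hx => ?_
      by_contra hxy
      have := monotone_cdf ν (not_le.1 hxy).le
      rw [hy] at this
      exact absurd (hb.trans_le this) (not_lt.2 hx)
  · rcases h0.eq_or_lt with rfl | h0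
    · exact measureReal_nonneg
    · obtain ⟨y, hy⟩ := exists_cdf_eq (ν := ν) h0 h1
      conv_lhs => rw [← hy, cdf_eq_real]
      refine measureReal_mono fun x hx => ?_
      exact (monotone_cdf ν hx).trans hy.le

/-- The probability integral transform. -/
lemma map_cdf_eq_volume_restrict [NullSingletonClass ν] : ν.map (cdf ν) = volume.restrict (Icc 0 1) := by
  have hm : Measurable (cdf ν) := (monotone_cdf ν).measurable
  have : IsProbabilityMeasure (ν.map (cdf ν)) := Measure.isProbabilityMeasure_map hm.aemeasurable
  refine Measure.ext_of_Iic _ _ fun a => ?_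
  rw [Measure.map_apply hm measurableSet_Iic, Measure.restrict_apply measurableSet_Iic]
  rcases lt_or_ge a 0 with h0 | h0
  · have e1 : cdf ν ⁻¹' Iic a = ∅ := by
      ext x; simpa using h0.trans_le (cdf_nonneg ν x)
    have e2 : Iic a ∩ Icc 0 1 = ∅ := by
      ext x; simp only [mem_inter_iff, mem_Iic, mem_Icc, mem_empty_iff_false, iff_false]
      intro h; linarith [h.1, h.2.1]
    rw [e1, e2]; simp
  rcases lt_or_ge a 1 with h1 | h1
  · have e2 : Iic a ∩ Icc 0 1 = Icc 0 a := by
      ext x; simp only [mem_inter_iff, mem_Iic, mem_Icc]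
      constructor
      · intro h; exact ⟨h.2.1, h.1⟩
      · intro h; exact ⟨h.2, h.1, h.2.trans h1.le⟩
    rw [e2, Real.volume_Icc, sub_zero, ← ofReal_measureReal]
    exact congrArg _ (measureReal_cdf_le h0 h1)
  · have e1 : cdf ν ⁻¹' Iic a = univ := by
      ext x; simpa using (cdf_le_one ν x).trans h1
    have e2 : Iic a ∩ Icc 0 1 = Icc 0 1 := inter_eq_right.2 fun x hx => hx.2.trans h1
    rw [e1, e2]; simp

/-- Since F(X) is uniform on [0, 1], the expectation of 1 / h(F(X)) is ∫₀¹ 1/h. -/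
lemma MemH.integrable_inv_comp_cdf [NullSingletonClass ν] {h : ℝ → ℝ} (hh : MemH h)
    (hlt : ∀ x, cdf ν x < 1) : Integrable (fun x => (h (cdf ν x))⁻¹) ν := by
  have hm : Measurable (cdf ν) := (monotone_cdf ν).measurable
  refine ⟨(hh.monotone_inv_comp_cdf hlt).measurable.aestronglyMeasurable, ?_⟩
  rw [hasFiniteIntegral_iff_ofReal
    (Eventually.of_forall fun x => inv_nonneg.2 (hh.nonneg _ (cdf_mem_Icc ν x)))]
  have hg : AEMeasurable (fun t => (ENNReal.ofReal (h t))⁻¹) (ν.map (cdf ν)) := by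
    rw [map_cdf_eq_volume_restrict]
    exact (aemeasurable_restrict_of_antitoneOn measurableSet_Icc hh.antitone).ennreal_ofReal.inv
  have := lintegral_map' hg hm.aemeasurable
  rw [map_cdf_eq_volume_restrict] at this
  refine lt_of_le_of_lt (le_of_eq ?_) (this ▸ hh.lintegral_inv_lt_top)
  refine lintegral_congr fun x => ?_
  rw [ENNReal.ofReal_inv_of_pos (hh.pos (cdf_nonneg ν x) (hlt x))]

end Distribution

/-! ### Empirical distribution functions as averages -/

section Empirical

variable {Ω : Type*} {X : ℕ → Ω → ℝ}

lemma empiricalCDF_eq_average (n : ℕ) (ω : Ω) (x : ℝ) :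
    empiricalCDF X n ω x
      = (∑ i ∈ Finset.range n, (Iic x).indicator (fun _ => (1 : ℝ)) (X i ω)) / n := by
  simp only [empiricalCDF, indicator_apply, mem_Iic, Finset.sum_boole]

lemma survival_empiricalCDF {n : ℕ} (hn : 0 < n) (ω : Ω) (x : ℝ) :
    survival (empiricalCDF X n ω) x
      = (∑ i ∈ Finset.range n, (Ioi x).indicator (fun _ => (1 : ℝ)) (X i ω)) / n := by
  have hn' : (n : ℝ) ≠ 0 := by positivity
  rw [survival, empiricalCDF_eq_average, eq_div_iff hn', sub_mul, div_mul_cancel₀ _ hn', one_mul,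
    sub_eq_iff_eq_add, ← Finset.sum_add_distrib]
  have : ∀ i ∈ Finset.range n, (Ioi x).indicator (fun _ => (1 : ℝ)) (X i ω)
      + (Iic x).indicator (fun _ => (1 : ℝ)) (X i ω) = 1 := fun i _ => by
    by_cases h : X i ω ≤ x
    · simp [h]
    · simp [h, not_le.1 h]
  rw [Finset.sum_congr rfl this]; simp

lemma monotone_empiricalCDF (n : ℕ) (ω : Ω) : Monotone (empiricalCDF X n ω) := fun x y hxy => by
  unfold empiricalCDF
  gcongr

lemma abs_survival_sub_survival (G H : ℝ → ℝ) (x : ℝ) :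
    |survival G x - survival H x| = |G x - H x| := by
  rw [survival, survival, abs_sub_comm]; congr 1; ring

end Empirical

/-! ### Glivenko–Cantelli theorems from the strong law -/

section StrongLaw

variable {Ω : Type*} [MeasurableSpace Ω] {P : Measure Ω}
  {X : ℕ → Ω → ℝ} {ν : Measure ℝ}

lemma ae_tendsto_average (hlaw : ∀ i, HasLaw (X i) ν P) (hindep : iIndepFun X P)
    {g : ℝ → ℝ} (hg : Measurable g) (hgi : Integrable g ν) :
    ∀ᵐ ω ∂P, Tendsto (fun n : ℕ => (∑ i ∈ Finset.range n, g (X i ω)) / n) atTop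
      (𝓝 (∫ x, g x ∂ν)) := by
  have h := strong_law_ae_real (μ := P) (fun i ω => g (X i ω)) ?_ ?_ ?_
  · have e : ∫ ω, g (X 0 ω) ∂P = ∫ x, g x ∂ν := (hlaw 0).integral_comp hg.aestronglyMeasurable
    rwa [e] at h
  · have := (hlaw 0).map_eq ▸ hgi
    exact this.comp_aemeasurable (hlaw 0).aemeasurable
  · intro i j hij
    exact (hindep.indepFun hij).comp hg hg
  · intro i
    exact IdentDistrib.comp ⟨(hlaw i).aemeasurable, (hlaw 0).aemeasurable,
      (hlaw i).map_eq.trans (hlaw 0).map_eq.symm⟩ hg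

variable [IsProbabilityMeasure ν]

lemma ae_tendsto_empiricalCDF (hlaw : ∀ i, HasLaw (X i) ν P) (hindep : iIndepFun X P) (x : ℝ) :
    ∀ᵐ ω ∂P, Tendsto (fun n : ℕ => empiricalCDF X n ω x) atTop (𝓝 (cdf ν x)) := by
  have h := ae_tendsto_average hlaw hindep (g := (Iic x).indicator fun _ => (1 : ℝ))
    (measurable_const.indicator measurableSet_Iic)
    ((integrable_const _).indicator measurableSet_Iic)
  filter_upwards [h] with ω hω
  rw [integral_indicator_const _ measurableSet_Iic, smul_eq_mul, mul_one, ← cdf_eq_real] at hω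
  simpa only [empiricalCDF_eq_average] using hω

/-- The Glivenko–Cantelli theorem for a continuous distribution, uniformly on bounded intervals. -/
lemma ae_eventually_abs_empiricalCDF_sub_cdf_le [NullSingletonClass ν] (hlaw : ∀ i, HasLaw (X i) ν P)
    (hindep : iIndepFun X P) :
    ∀ᵐ ω ∂P, ∀ K : ℝ, ∀ ε > 0, ∀ᶠ n in atTop, ∀ x ∈ Icc 0 K,
      |empiricalCDF X n ω x - cdf ν x| ≤ ε := by
  filter_upwards [ae_all_iff.2 fun q : ℚ => ae_tendsto_empiricalCDF hlaw hindep (q : ℝ)]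
    with ω hω K ε hε
  have huc := isCompact_Icc (a := (0 : ℝ)) (b := K + 1) |>.uniformContinuousOn_of_continuous
    (continuous_cdf (ν := ν)).continuousOn
  obtain ⟨δ, hδ, hδ'⟩ := Metric.uniformContinuousOn_iff.1 huc (ε / 2) (by positivity)
  -- A rational mesh keeps the grid inside the countable set where convergence is known. Being below
  -- 1, it keeps the grid points around x inside [0, K + 1]. Monotonicity of Fₙ then interpolates
  -- between neighbours.
  obtain ⟨q, hq0, hq⟩ := exists_rat_btwn (lt_min hδ one_pos)
  obtain ⟨hqδ, hq1⟩ := lt_min_iff.1 hq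
  have hfin : ∀ᶠ n in atTop, ∀ i ∈ Finset.range (⌊K / q⌋₊ + 2),
      |empiricalCDF X n ω ((i * q : ℚ) : ℝ) - cdf ν ((i * q : ℚ) : ℝ)| < ε / 2 := by
    rw [Finset.eventually_all]
    intro i _
    have := (hω (i * q)).sub_const (cdf ν ((i * q : ℚ) : ℝ)) |>.abs
    rw [sub_self, abs_zero] at this
    exact this.eventually_lt_const (by positivity)
  filter_upwards [hfin] with n hn x hx
  set i := ⌊x / q⌋₊ with hi
  have hxq : 0 ≤ x / q := div_nonneg hx.1 hq0.le
  have h1 : (i : ℝ) * q ≤ x := (le_div_iff₀ hq0).1 (Nat.floor_le hxq)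
  have h2 : x < ((i : ℝ) + 1) * q := (div_lt_iff₀ hq0).1 (Nat.lt_floor_add_one _)
  have hiK : i ≤ ⌊K / q⌋₊ := Nat.floor_mono (div_le_div_of_nonneg_right hx.2 hq0.le)
  have a1 := hn i (Finset.mem_range.2 (by omega))
  have a2 := hn (i + 1) (Finset.mem_range.2 (by omega))
  push_cast at a1 a2
  have hi0 : 0 ≤ (i : ℝ) * q := by positivity
  have b1 := hδ' (i * q) ⟨hi0, by linarith [hx.2]⟩ x ⟨hx.1, by linarith [hx.2]⟩ (by
    rw [Real.dist_eq, abs_lt]; constructor <;> linarith)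
  have b2 := hδ' ((i + 1) * q) ⟨by linarith, by linarith [hx.2]⟩ x ⟨hx.1, by linarith [hx.2]⟩ (by
    rw [Real.dist_eq, abs_lt]; constructor <;> linarith)
  rw [Real.dist_eq] at b1 b2
  have m1 := monotone_empiricalCDF (X := X) n ω h1
  have m2 := monotone_empiricalCDF (X := X) n ω h2.le
  rw [abs_lt] at a1 a2 b1 b2
  rw [abs_le]
  constructor <;> linarith [a1.1, a1.2, a2.1, a2.2, b1.1, b1.2, b2.1, b2.2]

/-- The Glivenko–Cantelli theorem in the norm weighted by `1 / h`, `h ∈ 𝓗(↓)`. -/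
lemma ae_eventually_abs_empiricalCDF_sub_cdf_le_mul [NullSingletonClass ν] (hlt : ∀ x, cdf ν x < 1)
    (hlaw : ∀ i, HasLaw (X i) ν P) (hindep : iIndepFun X P) {h : ℝ → ℝ} (hh : MemH h) :
    ∀ᵐ ω ∂P, ∀ ε > 0, ∀ᶠ n in atTop, ∀ x, 0 ≤ x →
      |empiricalCDF X n ω x - cdf ν x| ≤ ε * h (cdf ν x) := by
  set G : ℝ → ℝ := fun x => (h (cdf ν x))⁻¹ with hG
  have hGmono : Monotone G := hh.monotone_inv_comp_cdf hlt
  have hpos : ∀ x, 0 < h (cdf ν x) := fun x => hh.pos (cdf_nonneg ν x) (hlt x)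
  have hGpos : ∀ x, 0 < G x := fun x => inv_pos.2 (hpos x)
  have hGint : Integrable G ν := hh.integrable_inv_comp_cdf hlt
  have hslln := ae_all_iff.2 fun K : ℕ => ae_tendsto_average hlaw hindep
    (g := (Ioi (K : ℝ)).indicator G) (hGmono.measurable.indicator measurableSet_Ioi)
    (hGint.indicator measurableSet_Ioi)
  have htail : Tendsto (fun K : ℕ => ∫ x, (Ioi (K : ℝ)).indicator G x ∂ν) atTop (𝓝 0) := by
    have := tendsto_integral_of_dominated_convergence (μ := ν)
      (F := fun (K : ℕ) x => (Ioi (K : ℝ)).indicator G x) (f := fun _ => 0) G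
      (fun K => (hGmono.measurable.indicator measurableSet_Ioi).aestronglyMeasurable) hGint
      (fun K => Eventually.of_forall fun x => by
        rw [Real.norm_of_nonneg (indicator_nonneg (fun y _ => (hGpos y).le) x)]
        exact indicator_le_self' (fun y _ => (hGpos y).le) x)
      (Eventually.of_forall fun x => by
        refine tendsto_const_nhds.congr' ?_
        filter_upwards [eventually_ge_atTop ⌈x⌉₊] with K hK
        rw [indicator_of_notMem]
        simpa using (Nat.le_ceil x).trans (Nat.cast_le.2 hK))
    simpa using this
  filter_upwards [hslln, ae_eventually_abs_empiricalCDF_sub_cdf_le hlaw hindep] with ω h1 h2 ε hε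
  obtain ⟨K, hK⟩ := (htail.eventually_lt_const (half_pos hε)).exists
  filter_upwards [(h1 K).eventually_lt_const hK, eventually_gt_atTop 0,
    h2 K (ε * h (cdf ν K)) (mul_pos hε (hpos _))] with n hn1 hn hn2 x hx
  -- On [0, K] the weight is at least h(F(K)) > 0, so unweighted uniform convergence suffices.
  -- Beyond K, G = 1/h(F) is increasing, so a Markov-type bound gives S(x) G(x) ≤ ∫ G over (K, ∞),
  -- and likewise for the sample average; both are at most ε/2.
  rcases le_or_gt x K with hxK | hxK
  · exact (hn2 x ⟨hx, hxK⟩).trans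
      (mul_le_mul_of_nonneg_left (hh.antitone_comp_cdf hxK) hε.le)
  have key1 : survival (cdf ν) x * G x ≤ ε / 2 := by
    rw [survival_cdf_eq_measureReal_Ioi, ← smul_eq_mul, ← integral_indicator_const _ measurableSet_Ioi]
    refine (integral_mono ((integrable_const _).indicator measurableSet_Ioi)
      (hGint.indicator measurableSet_Ioi) fun y => ?_).trans hK.le
    by_cases hy : x < y
    · rw [indicator_of_mem (show y ∈ Ioi x from hy), indicator_of_mem (show y ∈ Ioi (K : ℝ) from hxK.trans hy)]
      exact hGmono hy.le
    · rw [indicator_of_notMem (show y ∉ Ioi x from hy)]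
      exact indicator_nonneg (fun y _ => (hGpos y).le) y
  have key2 : survival (empiricalCDF X n ω) x * G x ≤ ε / 2 := by
    rw [survival_empiricalCDF hn, div_mul_eq_mul_div, Finset.sum_mul]
    refine le_trans (div_le_div_of_nonneg_right (Finset.sum_le_sum fun i _ => ?_)
      (Nat.cast_nonneg n)) hn1.le
    by_cases hy : x < X i ω
    · rw [indicator_of_mem (show _ ∈ Ioi x from hy),
        indicator_of_mem (show _ ∈ Ioi (K : ℝ) from hxK.trans hy), one_mul]
      exact hGmono hy.le
    · rw [indicator_of_notMem (show _ ∉ Ioi x from hy), zero_mul]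
      exact indicator_nonneg (fun y _ => (hGpos y).le) _
  rw [hG] at key1 key2
  rw [← div_eq_mul_inv, div_le_iff₀ (hpos x)] at key1 key2
  rw [← abs_survival_sub_survival]
  have n1 : 0 ≤ survival (cdf ν) x := sub_nonneg.2 (cdf_le_one ν x)
  have n2 : 0 ≤ survival (empiricalCDF X n ω) x := by
    rw [survival_empiricalCDF hn]
    exact div_nonneg (Finset.sum_nonneg fun i _ => indicator_nonneg (by simp) _) (by positivity)
  rw [abs_le]
  constructor <;> linarith

end StrongLaw

/-! ### Lower bound for the empirical survival function -/

section LowerBound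

variable {Ω : Type*}

/-- The number of the first `n` observations that exceed `x`. -/
noncomputable def exceedances (X : ℕ → Ω → ℝ) (n : ℕ) (ω : Ω) (x : ℝ) : ℝ :=
  ∑ i ∈ Finset.range n, (Ioi x).indicator (fun _ => (1 : ℝ)) (X i ω)

lemma exceedances_mono {X : ℕ → Ω → ℝ} {ω : Ω} {m n : ℕ} (hmn : m ≤ n) (x : ℝ) :
    exceedances X m ω x ≤ exceedances X n ω x :=
  Finset.sum_le_sum_of_subset_of_nonneg (Finset.range_mono hmn)
    fun _ _ _ => indicator_nonneg (by simp) _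

lemma exceedances_antitone (X : ℕ → Ω → ℝ) (n : ℕ) (ω : Ω) : Antitone (exceedances X n ω) :=
  fun _ _ hxy => Finset.sum_le_sum fun _ _ =>
    indicator_le_indicator_of_subset (Ioi_subset_Ioi hxy) (fun _ => zero_le_one) _

variable [MeasurableSpace Ω] {P : Measure Ω}
  {X : ℕ → Ω → ℝ} {ν : Measure ℝ} [IsProbabilityMeasure ν]

lemma mgf_indicator_Ioi {Y : Ω → ℝ} (hY : HasLaw Y ν P) (x s : ℝ) :
    mgf (fun ω => (Ioi x).indicator (fun _ => (1 : ℝ)) (Y ω)) P s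
      = 1 + survival (cdf ν) x * (Real.exp s - 1) := by
  have hm : Measurable ((Ioi x).indicator fun _ : ℝ => (1 : ℝ)) :=
    measurable_const.indicator measurableSet_Ioi
  have e : ∀ y, Real.exp (s * (Ioi x).indicator (fun _ => (1 : ℝ)) y)
      = 1 + (Ioi x).indicator (fun _ => Real.exp s - 1) y := fun y => by
    by_cases h : x < y <;> simp [h]
  have h1 := hY.integral_comp
    (f := fun y => Real.exp (s * (Ioi x).indicator (fun _ => (1 : ℝ)) y))
    (by fun_prop)
  rw [mgf]
  refine h1.trans ?_
  simp_rw [e]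
  rw [integral_add (integrable_const _) ((integrable_const _).indicator measurableSet_Ioi),
    integral_indicator_const _ measurableSet_Ioi, survival_cdf_eq_measureReal_Ioi]
  simp

variable [IsProbabilityMeasure P]

/-- A Chernoff bound for the lower tail of a binomial distribution. -/
lemma measure_exceedances_le (hlaw : ∀ i, HasLaw (X i) ν P) (hindep : iIndepFun X P)
    (n : ℕ) (x β : ℝ) {s : ℝ} (hs : 0 ≤ s) :
    P {ω | exceedances X n ω x ≤ β * (n * survival (cdf ν) x)}
      ≤ ENNReal.ofReal
          (Real.exp (-(n * survival (cdf ν) x * (1 - Real.exp (-s) - s * β)))) := by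
  set p := survival (cdf ν) x with hp
  have hm : Measurable ((Ioi x).indicator fun _ : ℝ => (1 : ℝ)) :=
    measurable_const.indicator measurableSet_Ioi
  have hae : ∀ i, AEMeasurable (fun ω => (Ioi x).indicator (fun _ => (1 : ℝ)) (X i ω)) P :=
    fun i => hm.comp_aemeasurable (hlaw i).aemeasurable
  have hind : iIndepFun (fun i ω => (Ioi x).indicator (fun _ => (1 : ℝ)) (X i ω)) P :=
    hindep.comp (fun _ => (Ioi x).indicator fun _ => (1 : ℝ)) fun _ => hm
  have hsum : (fun ω => exceedances X n ω x)
      = ∑ i ∈ Finset.range n, fun ω => (Ioi x).indicator (fun _ => (1 : ℝ)) (X i ω) := by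
    ext ω; simp [exceedances, Finset.sum_apply]
  have hmgf : mgf (fun ω => exceedances X n ω x) P (-s) = (1 + p * (Real.exp (-s) - 1)) ^ n := by
    rw [hsum, hind.mgf_sum₀ hae, Finset.prod_congr rfl
      fun i _ => mgf_indicator_Ioi (hlaw i) x (-s)]
    simp [hp]
  have hnn : ∀ ω, 0 ≤ exceedances X n ω x := fun ω =>
    Finset.sum_nonneg fun _ _ => indicator_nonneg (by simp) _
  have hmeas : AEMeasurable (fun ω => exceedances X n ω x) P := by
    rw [hsum]; exact Finset.aemeasurable_sum _ fun i _ => hae i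
  have hint : Integrable (fun ω => Real.exp (-s * exceedances X n ω x)) P := by
    refine Integrable.of_bound (C := 1) (by fun_prop) (Eventually.of_forall fun ω => ?_)
    rw [Real.norm_of_nonneg (Real.exp_nonneg _), Real.exp_le_one_iff]
    nlinarith [hnn ω]
  have hb := measure_le_le_exp_mul_mgf (β * (n * p)) (neg_nonpos.2 hs) hint
  rw [hmgf, neg_neg] at hb
  have h0 : 0 ≤ 1 + p * (Real.exp (-s) - 1) := by
    have hp0 : 0 ≤ p := sub_nonneg.2 (cdf_le_one ν x)
    have hp1 : p ≤ 1 := sub_le_self _ (cdf_nonneg ν x)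
    nlinarith [Real.exp_nonneg (-s)]
  have h1 : (1 + p * (Real.exp (-s) - 1)) ^ n ≤ Real.exp (n * (p * (Real.exp (-s) - 1))) := by
    rw [Real.exp_nat_mul]
    exact pow_le_pow_left₀ h0 (by linarith [Real.add_one_le_exp (p * (Real.exp (-s) - 1))]) n
  rw [← ofReal_measureReal]
  refine ENNReal.ofReal_le_ofReal (hb.trans ((mul_le_mul_of_nonneg_left h1
    (Real.exp_nonneg _)).trans_eq ?_))
  rw [← Real.exp_add]
  congr 1; ring

/-- Put δ = (1 - 1/α)/3, take s with exp(-s) < δ and β = δ/s; the bracket exceeds 1 - 2δ > 1/α. Thus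
the Chernoff exponent at expected count α log log n can beat log log n, at the price of a small β.
-/
lemma exists_chernoff_constants {α : ℝ} (hα : 1 < α) :
    ∃ s β : ℝ, 0 ≤ s ∧ 0 < β ∧ 1 < α * (1 - Real.exp (-s) - s * β) := by
  have hδ : 0 < (1 - α⁻¹) / 3 := by
    have := inv_lt_one_of_one_lt₀ hα
    linarith
  obtain ⟨s, hs1, hs0⟩ := ((Real.tendsto_exp_neg_atTop_nhds_zero.eventually_lt_const hδ).and
    (eventually_gt_atTop 0)).exists
  refine ⟨s, (1 - α⁻¹) / 3 / s, hs0.le, by positivity, ?_⟩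
  rw [mul_div_cancel₀ _ hs0.ne']
  have h1 : α * α⁻¹ = 1 := mul_inv_cancel₀ (by positivity)
  have : α⁻¹ < 1 - Real.exp (-s) - (1 - α⁻¹) / 3 := by linarith
  calc 1 = α * α⁻¹ := h1.symm
    _ < _ := mul_lt_mul_of_pos_left this (by positivity)

/-- Geometric series: q / (1 - q) ≤ 2q for q ≤ 1/2. It sums the failure probabilities over all
dyadic levels. -/
lemma tsum_ofReal_exp_le {L : ℝ} (hL : Real.exp (-L) ≤ 1 / 2) :
    ∑' j : ℕ, ENNReal.ofReal (Real.exp (-(L * (j + 1)))) ≤ ENNReal.ofReal (2 * Real.exp (-L)) := by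
  set q := Real.exp (-L) with hq
  have hq0 : 0 < q := Real.exp_pos _
  have e : ∀ j : ℕ, Real.exp (-(L * (j + 1))) = q * q ^ j := fun j => by
    rw [hq, ← Real.exp_nat_mul, ← Real.exp_add]; congr 1; ring
  simp_rw [e]
  have hs := hasSum_geometric_of_lt_one hq0.le (by linarith : q < 1)
  rw [← ENNReal.ofReal_tsum_of_nonneg (fun j => by positivity) (hs.mul_left q).summable,
    (hs.mul_left q).tsum_eq]
  refine ENNReal.ofReal_le_ofReal ?_
  rw [mul_comm 2]
  refine mul_le_mul_of_nonneg_left ?_ hq0.le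
  rw [inv_le_comm₀ (by linarith) (by norm_num)]
  linarith

/-- Along the geometric subsequence `⌈ρ ^ k⌉`, the ratio of empirical and true survival functions
is bounded below on a dyadic grid of levels starting at `α log log (ρ ^ k) / ρ ^ (k + 1)`. -/
lemma ae_eventually_exceedances_grid (hlaw : ∀ i, HasLaw (X i) ν P) (hindep : iIndepFun X P)
    {α s β ρ : ℝ} (hα : 0 < α) (hs : 0 ≤ s) (hρ : 1 < ρ)
    (hγ : ρ < α * (1 - Real.exp (-s) - s * β)) (y : ℕ → ℕ → ℝ) :
    ∀ᵐ ω ∂P, ∀ᶠ k : ℕ in atTop, ∀ j,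
      survival (cdf ν) (y k j) = α * Real.log (k * Real.log ρ) / ρ ^ (k + 1) * 2 ^ j →
      β * (⌈ρ ^ k⌉₊ * survival (cdf ν) (y k j)) < exceedances X ⌈ρ ^ k⌉₊ ω (y k j) := by
  set c := 1 - Real.exp (-s) - s * β with hc
  have hρ0 : 0 < ρ := one_pos.trans hρ
  have hlog : 0 < Real.log ρ := Real.log_pos hρ
  have hc0 : 0 < c := by
    by_contra h
    nlinarith [mul_nonneg hα.le (neg_nonneg.2 (not_lt.1 h))]
  -- The decay exponent: the failure probability at stage k is at most 2 (k log ρ)^(-γ), summable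
  -- because ρ < α c.
  set γ := α * c / ρ with hγ_def
  have hγ1 : 1 < γ := (one_lt_div hρ0).2 hγ
  set u : ℕ → ℝ := fun k => k * Real.log ρ with hu
  -- The first two conditions hold for all large k; building them into the bad event makes the bound
  -- on `P (E k)` valid for every k.
  set E : ℕ → Set Ω := fun k => {ω | (1 < u k ∧ Real.exp (-(γ * Real.log (u k))) ≤ 1 / 2) ∧ ∃ j,
      survival (cdf ν) (y k j) = α * Real.log (u k) / ρ ^ (k + 1) * 2 ^ j ∧
      exceedances X ⌈ρ ^ k⌉₊ ω (y k j) ≤ β * (⌈ρ ^ k⌉₊ * survival (cdf ν) (y k j))} with hE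
  have hPE : ∀ k, P (E k) ≤ ENNReal.ofReal (2 * (u k) ^ (-γ)) := by
    intro k
    by_cases hk : 1 < u k ∧ Real.exp (-(γ * Real.log (u k))) ≤ 1 / 2
    swap
    · have : E k = ∅ := by ext ω; simp only [hE, mem_ofPred_eq, hk, false_and, mem_empty_iff_false]
      rw [this]; simp
    have hL : 0 < Real.log (u k) := Real.log_pos hk.1
    have hq : Real.exp (-(γ * Real.log (u k))) = (u k) ^ (-γ) := by
      rw [Real.rpow_def_of_pos (one_pos.trans hk.1)]; congr 1; ring
    have hsub : E k ⊆ ⋃ j, {ω | survival (cdf ν) (y k j)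
        = α * Real.log (u k) / ρ ^ (k + 1) * 2 ^ j ∧
        exceedances X ⌈ρ ^ k⌉₊ ω (y k j) ≤ β * (⌈ρ ^ k⌉₊ * survival (cdf ν) (y k j))} := by
      rintro ω ⟨-, j, hj⟩
      exact mem_iUnion.2 ⟨j, hj⟩
    refine (measure_mono hsub).trans ((measure_iUnion_le _).trans ?_)
    rw [← hq]
    refine (ENNReal.tsum_le_tsum fun j => ?_).trans (tsum_ofReal_exp_le hk.2)
    by_cases hj : survival (cdf ν) (y k j) = α * Real.log (u k) / ρ ^ (k + 1) * 2 ^ j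
    swap
    · simp only [hj, false_and, ofPred_false, measure_empty, zero_le]
    refine (measure_mono fun ω hω => hω.2).trans
      ((measure_exceedances_le hlaw hindep _ _ β hs).trans (ENNReal.ofReal_le_ofReal ?_))
    rw [Real.exp_le_exp, neg_le_neg_iff, hj]
    -- Weakening 2^j to j + 1 in the exponent leaves a geometric series in j.
    have h2 : (j : ℝ) + 1 ≤ 2 ^ j := by exact_mod_cast Nat.lt_two_pow_self (n := j)
    calc γ * Real.log (u k) * (j + 1) ≤ γ * Real.log (u k) * 2 ^ j := by gcongr
      _ = ρ ^ k * (α * Real.log (u k) / ρ ^ (k + 1) * 2 ^ j) * c := by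
        rw [hγ_def, pow_succ]; field_simp
      _ ≤ _ := by gcongr; exact Nat.le_ceil _
  have hsum : ∑' k, P (E k) ≠ ∞ := by
    refine ne_top_of_le_ne_top ?_ (ENNReal.tsum_le_tsum hPE)
    have : Summable fun k : ℕ => 2 * (u k) ^ (-γ) := by
      have h1 : Summable fun k : ℕ => (k : ℝ) ^ (-γ) := Real.summable_nat_rpow.2 (by linarith)
      refine ((h1.mul_right (Real.log ρ ^ (-γ))).mul_left 2).congr fun k => ?_
      rw [hu, Real.mul_rpow (Nat.cast_nonneg k) hlog.le]
    exact this.tsum_ofReal_ne_top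
  have hu_top : Tendsto u atTop atTop := tendsto_natCast_atTop_atTop.atTop_mul_const hlog
  have hq_zero : Tendsto (fun k => Real.exp (-(γ * Real.log (u k)))) atTop (𝓝 0) :=
    Real.tendsto_exp_neg_atTop_nhds_zero.comp
      ((Real.tendsto_log_atTop.comp hu_top).const_mul_atTop (by linarith))
  filter_upwards [ae_eventually_notMem hsum] with ω hω
  filter_upwards [hω, hu_top.eventually_gt_atTop 1,
    hq_zero.eventually_le_const (by norm_num : (0 : ℝ) < 1 / 2)] with k hk h1 h2 j hj
  by_contra hcon
  exact hk ⟨⟨h1, h2⟩, j, hj, not_lt.1 hcon⟩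

lemma exists_two_pow_lt_le {r : ℝ} (hr : 1 < r) : ∃ j : ℕ, 2 ^ j < r ∧ r ≤ 2 ^ (j + 1) := by
  obtain ⟨z, hz1, hz2⟩ := exists_mem_Ioc_zpow (one_pos.trans hr) (one_lt_two (α := ℝ))
  have : 0 < z + 1 := by
    by_contra h
    exact (hr.trans_le hz2).not_ge (zpow_le_one_of_nonpos₀ one_le_two (not_lt.1 h))
  lift z to ℕ using by omega
  exact ⟨z, by exact_mod_cast hz1, by exact_mod_cast hz2⟩

/-- Almost surely, for all large `n` the empirical survival function is at least a fixed multiple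
of the true one wherever the latter is at least `α n⁻¹ log log n`. -/
lemma exists_ae_eventually_mul_survival_le [NullSingletonClass ν]
    (hlaw : ∀ i, HasLaw (X i) ν P) (hindep : iIndepFun X P) {α : ℝ} (hα : 1 < α) :
    ∃ β > 0, ∀ᵐ ω ∂P, ∀ᶠ n : ℕ in atTop, ∀ x, aSeq α n ≤ survival (cdf ν) x →
      β * survival (cdf ν) x ≤ survival (empiricalCDF X n ω) x := by
  obtain ⟨s, β, hs, hβ, hsβ⟩ := exists_chernoff_constants hα
  obtain ⟨ρ, hρ, hργ⟩ := exists_between hsβ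
  have hρ0 : 0 < ρ := one_pos.trans hρ
  have hα0 : 0 < α := one_pos.trans hα
  have hlog : 0 < Real.log ρ := Real.log_pos hρ
  have hQ : ∀ t : ℝ, ∃ z, 0 < t → t < 1 → survival (cdf ν) z = t := by
    intro t
    by_cases h : 0 < t ∧ t < 1
    · obtain ⟨z, hz⟩ := exists_cdf_eq (ν := ν) (a := 1 - t) (by linarith [h.2]) (by linarith [h.1])
      exact ⟨z, fun _ _ => by rw [survival, hz]; ring⟩
    · exact ⟨0, fun h0 h1 => absurd ⟨h0, h1⟩ h⟩
  choose Q hQ using hQ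
  set A : ℕ → ℝ := fun k => α * Real.log (k * Real.log ρ) / ρ ^ (k + 1) with hA
  -- The factor 2 is lost in rounding S(x) down to a dyadic level, the factor ρ in replacing n <
  -- ρ^(k+1) by ⌈ρ^k⌉.
  refine ⟨β / (2 * ρ), by positivity, ?_⟩
  filter_upwards [ae_eventually_exceedances_grid hlaw hindep hα0 hs hρ hργ
    fun k j => Q (A k * 2 ^ j)] with ω hω
  have hu_top : Tendsto (fun k : ℕ => k * Real.log ρ) atTop atTop :=
    tendsto_natCast_atTop_atTop.atTop_mul_const hlog
  obtain ⟨K, hK⟩ := eventually_atTop.1 (hω.and (hu_top.eventually_gt_atTop 1))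
  filter_upwards [tendsto_natCast_atTop_atTop.eventually_ge_atTop (ρ ^ (K + 1)),
    eventually_gt_atTop 0] with n hnK hn0 x hx
  have hn0' : (0 : ℝ) < n := Nat.cast_pos.2 hn0
  obtain ⟨k, hk1, hk2⟩ := exists_nat_pow_near (Nat.one_le_cast.2 hn0 : (1 : ℝ) ≤ n) hρ
  have hKk : K ≤ k := by
    have := (pow_lt_pow_iff_right₀ hρ).1 (hnK.trans_lt hk2)
    omega
  obtain ⟨hgrid, hu1⟩ := hK k hKk
  have hA0 : 0 < A k := by have := Real.log_pos hu1; positivity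
  -- The lowest level pairs log log of ρ^k with division by ρ^(k+1), so it lies below aₙ for every n
  -- in the block [ρ^k, ρ^(k+1)).
  have hAa : A k < aSeq α n := by
    have h1 : Real.log (k * Real.log ρ) ≤ Real.log (Real.log n) := by
      rw [← Real.log_pow] at hu1 ⊢
      exact Real.log_le_log (by linarith) (Real.log_le_log (by positivity) hk1)
    have h2 := Real.log_pos hu1
    have : A k = α * (ρ ^ (k + 1))⁻¹ * Real.log (k * Real.log ρ) := by rw [hA]; ring
    rw [this, aSeq]
    calc _ < α * (n : ℝ)⁻¹ * Real.log (k * Real.log ρ) := by gcongr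
      _ ≤ _ := by gcongr
  have hp : A k < survival (cdf ν) x := hAa.trans_le hx
  obtain ⟨j, hj1, hj2⟩ := exists_two_pow_lt_le ((one_lt_div hA0).2 hp)
  rw [lt_div_iff₀' hA0] at hj1
  rw [div_le_iff₀' hA0, pow_succ, ← mul_assoc] at hj2
  have hp1 : survival (cdf ν) x ≤ 1 := sub_le_self _ (cdf_nonneg ν x)
  have hy := hQ (A k * 2 ^ j) (by positivity) (hj1.trans_le hp1)
  have hg := hgrid j hy
  rw [hy] at hg
  have hxy : x ≤ Q (A k * 2 ^ j) := by
    by_contra h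
    have := monotone_cdf ν (not_le.1 h).le
    rw [← hy] at hj1
    simp only [survival] at hj1
    linarith
  -- Counts grow with the sample size and as the threshold falls, so the grid bound at (⌈ρ^k⌉, y)
  -- transfers to (n, x).
  have hN := (exceedances_antitone X ⌈ρ ^ k⌉₊ ω hxy).trans
    (exceedances_mono (Nat.ceil_le.2 hk1) x)
  rw [survival_empiricalCDF hn0, le_div_iff₀ hn0']
  have hm : ρ ^ k ≤ (⌈ρ ^ k⌉₊ : ℝ) := Nat.le_ceil _
  calc β / (2 * ρ) * survival (cdf ν) x * n
      ≤ β / (2 * ρ) * (A k * 2 ^ j * 2) * ρ ^ (k + 1) := by gcongr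
    _ = β * (ρ ^ k * (A k * 2 ^ j)) := by rw [pow_succ]; field_simp
    _ ≤ β * (⌈ρ ^ k⌉₊ * (A k * 2 ^ j)) := by gcongr
    _ ≤ _ := hg.le.trans hN

end LowerBound

/-! ### Integrability of survival functions and the ratio estimate -/

section Integrability

/-- Layer-cake formula: the integral of P(X > t) over t > 0 is E(X), as X ≥ 0 almost surely. -/
lemma integrableOn_survival_cdf {ν : Measure ℝ} [IsProbabilityMeasure ν]
    (hmean : Integrable (fun x : ℝ => x) ν) (hF0 : cdf ν 0 = 0) :
    IntegrableOn (survival (cdf ν)) (Ioi 0) := by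
  have hanti : Antitone (survival (cdf ν)) := fun x y hxy =>
    sub_le_sub_left (monotone_cdf ν hxy) 1
  have hnn : ∀ x, 0 ≤ survival (cdf ν) x := fun x => sub_nonneg.2 (cdf_le_one ν x)
  refine ⟨hanti.measurable.aestronglyMeasurable, ?_⟩
  rw [hasFiniteIntegral_iff_ofReal (Eventually.of_forall hnn)]
  have hpos : 0 ≤ᵐ[ν] fun x : ℝ => x := by
    have : ν (Iic 0) = 0 := by rw [← ofReal_cdf, hF0, ENNReal.ofReal_zero]
    filter_upwards [measure_eq_zero_iff_ae_notMem.1 this] with x hx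
    exact (not_le.1 hx).le
  have h1 := lintegral_eq_lintegral_meas_lt ν hpos measurable_id.aemeasurable
  have h2 : ∫⁻ x, ENNReal.ofReal x ∂ν < ∞ :=
    (hasFiniteIntegral_iff_ofReal hpos).1 hmean.hasFiniteIntegral
  rw [h1] at h2
  refine lt_of_le_of_lt (le_of_eq (lintegral_congr fun t => ?_)) h2
  rw [survival_cdf_eq_measureReal_Ioi, ofReal_measureReal]
  rfl

variable {Ω : Type*} {X : ℕ → Ω → ℝ}

lemma integrableOn_survival_empiricalCDF {n : ℕ} (hn : 0 < n) (ω : Ω) (x : ℝ) :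
    IntegrableOn (survival (empiricalCDF X n ω)) (Ioi x) := by
  have : survival (empiricalCDF X n ω)
      = fun y => (∑ i ∈ Finset.range n, (Iio (X i ω)).indicator (fun _ => (1 : ℝ)) y) / n := by
    ext y
    rw [survival_empiricalCDF hn]
    simp [indicator_apply]
  rw [this]
  refine (integrable_finsetSum _ fun i _ => ?_).div_const _
  rw [integrable_indicator_iff measurableSet_Iio]
  refine integrableOn_const ?_
  rw [Measure.restrict_apply measurableSet_Iio, inter_comm, Ioi_inter_Iio]
  exact measure_Ioo_lt_top.ne

/-- Combined with the lower bound on Sₙ, this shows that the cut-off in `empiricalMRL` is inactive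
on [0, bₙ]. -/
lemma lt_sampleMax {n : ℕ} (hn : 0 < n) {ω : Ω} {x : ℝ}
    (h : 0 < survival (empiricalCDF X n ω) x) : x < sampleMax X n ω := by
  rw [survival_empiricalCDF hn] at h
  by_contra hcon
  refine h.ne' ?_
  rw [Finset.sum_eq_zero fun i hi => ?_, zero_div]
  refine indicator_of_notMem (not_lt.2 (le_trans ?_ (not_lt.1 hcon))) _
  exact le_ciSup (f := fun i : Fin n => X i ω) (Set.finite_range _).bddAbove
    ⟨i, Finset.mem_range.1 hi⟩

end Integrability

lemma meanResidualLife_pos {G : ℝ → ℝ} {x : ℝ} (hG : ∀ y, 0 < survival G y)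
    (hint : IntegrableOn (survival G) (Ioi x)) : 0 < meanResidualLife G x := by
  refine div_pos ?_ (hG x)
  rw [setIntegral_pos_iff_support_of_nonneg_ae (Eventually.of_forall fun y => (hG y).le) hint,
    eq_univ_of_forall (s := Function.support _) fun y => (hG y).ne', univ_inter]
  simp

lemma abs_meanResidualLife_sub_mul_le {G H : ℝ → ℝ} {x β : ℝ} (hβ : 0 < β)
    (hH : 0 < survival H x) (hGH : β * survival H x ≤ survival G x)
    (he : 0 ≤ meanResidualLife H x)
    (hGi : IntegrableOn (survival G) (Ioi x)) (hHi : IntegrableOn (survival H) (Ioi x)) :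
    |meanResidualLife G x - meanResidualLife H x| * survival H x
      ≤ β⁻¹ * (|∫ y in Ioi x, (survival G y - survival H y)|
        + meanResidualLife H x * |G x - H x|) := by
  have hG : 0 < survival G x := (mul_pos hβ hH).trans_le hGH
  have hid : (meanResidualLife G x - meanResidualLife H x) * survival H x
      = survival H x / survival G x * ((∫ y in Ioi x, (survival G y - survival H y))
        + meanResidualLife H x * (survival H x - survival G x)) := by
    rw [integral_sub hGi hHi, meanResidualLife, meanResidualLife]
    field_simp
    ring
  have habs : |meanResidualLife G x - meanResidualLife H x| * survival H x
      = |(meanResidualLife G x - meanResidualLife H x) * survival H x| := by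
    rw [abs_mul, abs_of_pos hH]
  rw [habs, hid, abs_mul, abs_of_pos (div_pos hH hG)]
  have hr : survival H x / survival G x ≤ β⁻¹ := by
    rw [div_le_iff₀ hG, ← div_eq_inv_mul, le_div_iff₀' hβ]
    exact hGH
  refine mul_le_mul hr ((abs_add_le _ _).trans_eq ?_) (abs_nonneg _) (inv_nonneg.2 hβ.le)
  rw [abs_mul, abs_of_nonneg he, abs_survival_sub_survival, abs_sub_comm]

/-! ### The range [0, bₙ] in terms of survival levels -/

section Range

lemma eventually_aSeq_le_one (α : ℝ) (hα : 0 < α) : ∀ᶠ n in atTop, aSeq α n ≤ 1 := by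
  have h := (Real.isLittleO_log_id_atTop.bound (inv_pos.2 hα)).filter_mono le_rfl
  filter_upwards [tendsto_natCast_atTop_atTop.eventually h,
    tendsto_natCast_atTop_atTop.eventually_gt_atTop (1 : ℝ)] with n hn hn1
  have hl : 0 < Real.log n := Real.log_pos hn1
  have hn0 : (0 : ℝ) < n := by linarith
  simp only [id, Real.norm_of_nonneg hl.le, Real.norm_of_nonneg hn0.le] at hn
  have hll : Real.log (Real.log n) ≤ Real.log n := by linarith [Real.log_le_sub_one_of_pos hl]
  calc aSeq α n = α * (n : ℝ)⁻¹ * Real.log (Real.log n) := rfl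
    _ ≤ α * (n : ℝ)⁻¹ * (α⁻¹ * n) := by gcongr; exact hll.trans hn
    _ = 1 := by field_simp

/-- Any y in [0, x) lies below the infimum bₙ, so F(y) < 1 - aₙ, and continuity passes this to x in
the limit. At x = 0 there is no such y; there S(0) = 1 and aₙ ≤ 1 is needed. -/
lemma aSeq_le_survival {ν : Measure ℝ} [IsProbabilityMeasure ν] [NullSingletonClass ν]
    (hF0 : cdf ν 0 = 0) {α : ℝ} {n : ℕ} (ha : aSeq α n ≤ 1) {x : ℝ}
    (hx : x ∈ Icc 0 (bSeq (cdf ν) α n)) : aSeq α n ≤ survival (cdf ν) x := by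
  rw [survival, le_sub_comm]
  rcases hx.1.eq_or_lt with rfl | hx0
  · rw [hF0]; linarith
  · refine le_of_tendsto ((continuous_cdf (ν := ν)).continuousWithinAt (s := Iio x) (x := x)) ?_
    filter_upwards [Ico_mem_nhdsLT hx0] with y hy
    by_contra hcon
    have : bSeq (cdf ν) α n ≤ y := csInf_le ⟨0, fun z hz => hz.1⟩ ⟨hy.1, (not_le.1 hcon).le⟩
    linarith [hx.2, hy.2]

end Range

lemma MemH.integrableOn_comp_cdf {ν : Measure ℝ} {h : ℝ → ℝ} (hh : MemH h) {s : Set ℝ}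
    (hfin : ∫⁻ y in s, ENNReal.ofReal (h (cdf ν y)) < ∞) :
    IntegrableOn (fun y => h (cdf ν y)) s :=
  ⟨hh.antitone_comp_cdf.measurable.aestronglyMeasurable,
    (hasFiniteIntegral_iff_ofReal
      (Eventually.of_forall fun x => hh.nonneg _ (cdf_mem_Icc ν x))).2 hfin⟩

/-- The divisions in `mOne` can be cleared because h(F(x)) and e(x) are positive. The case x = 0
also yields integrability of h(F) under Condition 1a. -/
lemma lintegral_comp_cdf_le_mOne_mul {ν : Measure ℝ} (hlt : ∀ x, cdf ν x < 1) {h : ℝ → ℝ} (hh : MemH h)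
    {x : ℝ} (hx : 0 ≤ x) (he : 0 < meanResidualLife (cdf ν) x) :
    ∫⁻ y in Ioi x, ENNReal.ofReal (h (cdf ν y))
      ≤ mOne h (cdf ν) * ENNReal.ofReal (h (cdf ν x) * meanResidualLife (cdf ν) x) := by
  have hp := hh.pos (cdf_nonneg ν x) (hlt x)
  have h1 : (∫⁻ y in Ioi x, ENNReal.ofReal (h (cdf ν y))) / ENNReal.ofReal (h (cdf ν x))
      / ENNReal.ofReal (meanResidualLife (cdf ν) x) ≤ mOne h (cdf ν) :=
    le_iSup₂ (f := fun (x : ℝ) (_ : x ∈ Ici (0 : ℝ)) =>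
      (∫⁻ y in Ioi x, ENNReal.ofReal (h (cdf ν y))) / ENNReal.ofReal (h (cdf ν x))
      / ENNReal.ofReal (meanResidualLife (cdf ν) x)) x hx
  rw [ENNReal.div_le_iff (by simpa using he) ENNReal.ofReal_ne_top,
    ENNReal.div_le_iff (by simpa using hp) ENNReal.ofReal_ne_top] at h1
  rwa [ENNReal.ofReal_mul hp.le, mul_comm (ENNReal.ofReal _), ← mul_assoc]

/-! ### Weighted consistency for a general weight -/

section Consistency

variable {Ω : Type*} [MeasurableSpace Ω] {P : Measure Ω} [IsProbabilityMeasure P]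
  {X : ℕ → Ω → ℝ} {ν : Measure ℝ} [IsProbabilityMeasure ν] [NullSingletonClass ν]

/-- Weighted uniform consistency of the empirical mean residual life function, for any weight `1/B`
such that `B` dominates `∫_x^∞ h(F(y)) dy + h(F(x)) e(x)`. -/
lemma ae_tendsto_iSup_empiricalMRL (hlt : ∀ x, cdf ν x < 1) (hF0 : cdf ν 0 = 0)
    (hmean : Integrable (fun x : ℝ => x) ν)
    (hlaw : ∀ i, HasLaw (X i) ν P) (hindep : iIndepFun X P) {α : ℝ} (hα : 1 < α)
    {h : ℝ → ℝ} (hh : MemH h)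
    (hint : IntegrableOn (fun y => h (cdf ν y)) (Ioi 0)) {B : ℝ → ℝ} (hB : ∀ x, 0 ≤ x → 0 < B x)
    {C : ℝ} (hC : 0 ≤ C) (hCB : ∀ x, 0 ≤ x → (∫ y in Ioi x, h (cdf ν y))
      + meanResidualLife (cdf ν) x * h (cdf ν x) ≤ C * B x) :
    ∀ᵐ ω ∂P, Tendsto
      (fun n : ℕ => ⨆ x ∈ Icc (0 : ℝ) (bSeq (cdf ν) α n),
        ENNReal.ofReal (|empiricalMRL X n ω x - meanResidualLife (cdf ν) x|
          * survival (cdf ν) x / B x))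
      atTop (𝓝 0) := by
  have hsurv : ∀ x, 0 < survival (cdf ν) x := fun x => sub_pos.2 (hlt x)
  have hSint : ∀ x, 0 ≤ x → IntegrableOn (survival (cdf ν)) (Ioi x) := fun x hx =>
    (integrableOn_survival_cdf hmean hF0).mono_set (Ioi_subset_Ioi hx)
  obtain ⟨β, hβ, hlow⟩ := exists_ae_eventually_mul_survival_le hlaw hindep hα
  filter_upwards [hlow, ae_eventually_abs_empiricalCDF_sub_cdf_le_mul hlt hlaw hindep hh]
    with ω h1 h2
  rw [ENNReal.tendsto_nhds_zero]
  intro ε' hε'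
  obtain ⟨ε, -, hε0, hε⟩ := ENNReal.lt_iff_exists_real_btwn.1 hε'
  rw [ENNReal.ofReal_pos] at hε0
  -- Chosen so that β⁻¹ δ C ≤ ε; C + 1 covers C = 0.
  set δ := ε * β / (C + 1) with hδ
  have hδ0 : 0 < δ := by positivity
  filter_upwards [h1, h2 δ hδ0, eventually_aSeq_le_one α (one_pos.trans hα),
    eventually_gt_atTop 0] with n hn1 hn2 ha hn0
  refine iSup₂_le fun x hx => le_trans (ENNReal.ofReal_le_ofReal ?_) hε.le
  rw [div_le_iff₀ (hB x hx.1)]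
  have hlow := hn1 x (aSeq_le_survival hF0 ha hx)
  have hmem : x ∈ Ico 0 (sampleMax X n ω) :=
    ⟨hx.1, lt_sampleMax hn0 ((mul_pos hβ (hsurv x)).trans_le hlow)⟩
  have he := (meanResidualLife_pos hsurv (hSint x hx.1)).le
  rw [empiricalMRL, indicator_of_mem hmem]
  refine (abs_meanResidualLife_sub_mul_le hβ (hsurv x) hlow he
    (integrableOn_survival_empiricalCDF hn0 ω x) (hSint x hx.1)).trans ?_
  have hI : |∫ y in Ioi x, (survival (empiricalCDF X n ω) y - survival (cdf ν) y)|
      ≤ δ * ∫ y in Ioi x, h (cdf ν y) := by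
    rw [← integral_const_mul]
    rw [← Real.norm_eq_abs]
    refine norm_integral_le_of_norm_le ((hint.mono_set (Ioi_subset_Ioi hx.1)).const_mul δ) ?_
    filter_upwards [ae_restrict_mem measurableSet_Ioi] with y hy
    rw [Real.norm_eq_abs, abs_survival_sub_survival]
    exact hn2 y (hx.1.trans hy.le)
  calc _ ≤ β⁻¹ * (δ * (∫ y in Ioi x, h (cdf ν y))
        + meanResidualLife (cdf ν) x * (δ * h (cdf ν x))) := by
        gcongr
        exact hn2 x hx.1
    _ = β⁻¹ * δ * ((∫ y in Ioi x, h (cdf ν y)) + meanResidualLife (cdf ν) x * h (cdf ν x)) := by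
        ring
    _ ≤ β⁻¹ * δ * (C * B x) := by gcongr; exact hCB x hx.1
    _ = ε * B x * (C / (C + 1)) := by rw [hδ]; field_simp
    _ ≤ ε * B x * 1 := by
        have := hB x hx.1
        gcongr
        exact div_le_one_of_le₀ (by linarith) (by linarith)
    _ = ε * B x := mul_one _

end Consistency

/-! ### Consequences of the positive density -/

section Density

variable {f : ℝ → ℝ} {ν : Measure ℝ} [IsProbabilityMeasure ν]

lemma cdf_zero_of_density [NullSingletonClass ν]
    (hν : ν = (volume.restrict (Ici 0)).withDensity (fun x => ENNReal.ofReal (f x))) :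
    cdf ν 0 = 0 := by
  have h0 : ν (Iio 0) = 0 := by
    rw [hν]
    refine withDensity_absolutelyContinuous _ _ ?_
    rw [Measure.restrict_apply measurableSet_Iio, Iio_inter_Ici, Ico_self, measure_empty]
  rw [cdf_eq_real, measureReal_def, ← measure_congr Iio_ae_eq_Iic, h0, ENNReal.toReal_zero]

lemma cdf_lt_one_of_density (hf_meas : Measurable f) (hf_pos : ∀ x, 0 < x → 0 < f x)
    (hν : ν = (volume.restrict (Ici 0)).withDensity (fun x => ENNReal.ofReal (f x))) (x : ℝ) :
    cdf ν x < 1 := by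
  rw [← sub_pos]
  change 0 < survival (cdf ν) x
  rw [survival_cdf_eq_measureReal_Ioi, measureReal_def, ENNReal.toReal_pos_iff]
  refine ⟨pos_iff_ne_zero.2 fun h => ?_, measure_lt_top _ _⟩
  rw [hν, withDensity_apply_eq_zero hf_meas.ennreal_ofReal] at h
  have hsub : Ioi (max x 0) ⊆ {y | ENNReal.ofReal (f y) ≠ 0} ∩ Ioi x := fun y hy => by
    rw [mem_Ioi, max_lt_iff] at hy
    exact ⟨by simpa using hf_pos y hy.2, hy.1⟩
  have h' := measure_mono_null hsub h
  rw [Measure.restrict_apply measurableSet_Ioi, inter_eq_left.2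
    (Ioi_subset_Ici_self.trans (Ici_subset_Ici.2 (le_max_right x 0))), Real.volume_Ioi] at h'
  exact ENNReal.top_ne_zero h'

end Density

end MRL

/-! ### The two conditions as choices of weight -/

theorem mainTheorem2 {Ω : Type*} [MeasurableSpace Ω] (P : Measure Ω) [IsProbabilityMeasure P]
    (X : ℕ → Ω → ℝ) (f : ℝ → ℝ) (hf_meas : Measurable f) (hf_pos : ∀ x, 0 < x → 0 < f x)
    (ν : Measure ℝ) [IsProbabilityMeasure ν]
    (hν : ν = (volume.restrict (Ici 0)).withDensity (fun x => ENNReal.ofReal (f x)))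
    (hmean : Integrable (fun x : ℝ => x) ν)
    (hlaw : ∀ i, HasLaw (X i) ν P) (hindep : iIndepFun X P)
    (F : ℝ → ℝ) (hF : ∀ x, F x = cdf ν x)
    (α : ℝ) (hα : 1 < α) :
    (∀ h : ℝ → ℝ, MRL.Condition1a h F →
      ∀ᵐ ω ∂P, Tendsto
        (fun n : ℕ => ⨆ x ∈ Icc (0 : ℝ) (MRL.bSeq F α n),
          ENNReal.ofReal (|MRL.empiricalMRL X n ω x - MRL.meanResidualLife F x|
            * MRL.survival F x / (h (F x) * MRL.meanResidualLife F x)))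
        atTop (𝓝 0)) ∧
    (MRL.Condition1b F →
      ∀ᵐ ω ∂P, Tendsto
        (fun n : ℕ => ⨆ x ∈ Icc (0 : ℝ) (MRL.bSeq F α n),
          ENNReal.ofReal (|MRL.empiricalMRL X n ω x - MRL.meanResidualLife F x|
            * MRL.survival F x))
        atTop (𝓝 0)) := by
  obtain rfl : F = cdf ν := funext hF
  have hatom : NullSingletonClass ν := by rw [hν]; infer_instance
  have hlt := MRL.cdf_lt_one_of_density hf_meas hf_pos hν
  have hF0 := MRL.cdf_zero_of_density hν
  have he : ∀ x, 0 ≤ x → 0 < MRL.meanResidualLife (cdf ν) x := fun x hx =>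
    MRL.meanResidualLife_pos (fun y => sub_pos.2 (hlt y))
      ((MRL.integrableOn_survival_cdf hmean hF0).mono_set (Ioi_subset_Ioi hx))
  have hnn : ∀ {h : ℝ → ℝ}, MRL.MemH h → ∀ x, 0 ≤ h (cdf ν x) := fun hh x =>
    hh.nonneg _ (MRL.cdf_mem_Icc ν x)
  constructor
  -- Weight B = h(F) e with C = M₁ + 1: M₁ bounds the integral term, and the extra 1 is the term e
  -- h(F) itself.
  · rintro h ⟨hh, hM⟩
    have hpos : ∀ x, 0 ≤ x → 0 < h (cdf ν x) * MRL.meanResidualLife (cdf ν) x := fun x hx =>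
      mul_pos (hh.pos (cdf_nonneg ν x) (hlt x)) (he x hx)
    have hle := fun x hx => MRL.lintegral_comp_cdf_le_mOne_mul hlt hh hx (he x hx)
    refine MRL.ae_tendsto_iSup_empiricalMRL hlt hF0 hmean hlaw hindep hα hh
      (hh.integrableOn_comp_cdf
        ((hle 0 le_rfl).trans_lt (ENNReal.mul_lt_top hM ENNReal.ofReal_lt_top)))
      hpos (C := (MRL.mOne h (cdf ν)).toReal + 1) (by positivity) fun x hx => ?_
    rw [add_mul, one_mul, mul_comm (MRL.meanResidualLife _ _)]
    refine add_le_add_left ?_ _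
    rw [integral_eq_lintegral_of_nonneg_ae (Eventually.of_forall (hnn hh))
      hh.antitone_comp_cdf.measurable.aestronglyMeasurable]
    have := ENNReal.toReal_mono (ENNReal.mul_lt_top hM ENNReal.ofReal_lt_top).ne (hle x hx)
    rwa [ENNReal.toReal_mul, ENNReal.toReal_ofReal (hpos x hx).le] at this
  -- Weight B = 1, with C the full integral of h(F) plus the supremum of e h(F).
  · rintro ⟨h, hh, hfin, hsup⟩
    have hint := hh.integrableOn_comp_cdf hfin
    set S := ⨆ x ∈ Ici (0 : ℝ), ENNReal.ofReal (MRL.meanResidualLife (cdf ν) x * h (cdf ν x))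
      with hS
    have hJ : 0 ≤ ∫ y in Ioi 0, h (cdf ν y) := integral_nonneg (hnn hh)
    have := MRL.ae_tendsto_iSup_empiricalMRL hlt hF0 hmean hlaw hindep hα hh hint
      (B := fun _ => 1) (fun _ _ => one_pos)
      (C := (∫ y in Ioi 0, h (cdf ν y)) + S.toReal) (by positivity) fun x hx => ?_
    · simpa only [div_one] using this
    rw [mul_one]
    refine add_le_add (setIntegral_mono_set hint (Eventually.of_forall (hnn hh))
      (Ioi_subset_Ioi hx).eventuallyLE) ?_
    refine (ENNReal.ofReal_le_iff_le_toReal hsup.ne).1 ?_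
    exact le_iSup₂ (f := fun (x : ℝ) (_ : x ∈ Ici (0 : ℝ)) =>
      ENNReal.ofReal (MRL.meanResidualLife (cdf ν) x * h (cdf ν x))) x hx
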